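/- Let $K$ be an arbitrary field (of any cardinality, finite or infinite), let $n$ be a positive integer, let $M_n(K)$ be the vector space of $n\times n$ matrices over $K$, and let $GL_n(K)\subseteq M_n(K)$ be the set of non-singular matrices. For $P,Q\in GL_n(K)$ let $u_{P,Q}$ and $v_{P,Q}$ be the linear automorphisms of $M_n(K)$ given by $u_{P,Q}(M)=PMQ$ and $v_{P,Q}(M)=PM^{t}Q$, where $M^t$ is the transpose of $M$. The Frobenius group is the subgroup $$\mathcal G_n(K)=\{u_{P,Q} : P,Q\in GL_n(K)\}\cup\{v_{P,Q} : P,Q\in GL_n(K)\}$$ of the group of linear automorphisms of $M_n(K)$. An affine endomorphism of $M_n(K)$ is a (not necessarily bijective) map of the form $M\mapsto L(M)+B$ with $L$ a $K$-linear endomorphism of $M_n(K)$ and $B\in M_n(K)$. Assume $n\neq 2$ or $|K|>2$. Then: (i) $\mathcal G_n(K)$ is exactly the set of all affine endomorphisms $u$ of $M_n(K)$ such that $u^{-1}(GL_n(K))=GL_n(K)$ (inverse image). (ii) If moreover $n>1$ or $|K|>2$, then $\mathcal G_n(K)$ is exactly the set of all affine endomorphisms $u$ of $M_n(K)$ such that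 $u(GL_n(K))=GL_n(K)$ (direct image). -/

import Mathlib

/-- The set `GL_n(K)` of non-singular matrices inside the algebra `M_n(K)`. -/
def nonsingularMatrices (n : ℕ) (K : Type*) [Field K] : Set (Matrix (Fin n) (Fin n) K) :=
  {M | IsUnit M}

/-- The linear automorphism `u_{P,Q} : M ↦ P M Q` of `M_n(K)`. -/
def frobeniusU {n : ℕ} {K : Type*} [Field K] (P Q : GL (Fin n) K) :
    Matrix (Fin n) (Fin n) K ≃ₗ[K] Matrix (Fin n) (Fin n) K where
  toFun M := P.val * M * Q.val
  map_add' A B := by rw [mul_add, add_mul]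
  map_smul' c A := by simp
  invFun M := P.inv * M * Q.inv
  left_inv M := by
    have hP := P.inv_val
    have hQ := Q.val_inv
    calc P.inv * (P.val * M * Q.val) * Q.inv
        = (P.inv * P.val) * M * (Q.val * Q.inv) := by simp only [mul_assoc]
      _ = M := by rw [hP, hQ, one_mul, mul_one]
  right_inv M := by
    have hP := P.val_inv
    have hQ := Q.inv_val
    calc P.val * (P.inv * M * Q.inv) * Q.val
        = (P.val * P.inv) * M * (Q.inv * Q.val) := by simp only [mul_assoc]
      _ = M := by rw [hP, hQ, one_mul, mul_one]

/-- The linear automorphism `v_{P,Q} : M ↦ P Mᵀ Q` of `M_n(K)`. -/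
def frobeniusV {n : ℕ} {K : Type*} [Field K] (P Q : GL (Fin n) K) :
    Matrix (Fin n) (Fin n) K ≃ₗ[K] Matrix (Fin n) (Fin n) K :=
  (Matrix.transposeLinearEquiv (Fin n) (Fin n) K K).trans (frobeniusU P Q)

theorem frobeniusU_apply {n : ℕ} {K : Type*} [Field K] (P Q : GL (Fin n) K)
    (M : Matrix (Fin n) (Fin n) K) : frobeniusU P Q M = P.val * M * Q.val := rfl

theorem frobeniusV_apply {n : ℕ} {K : Type*} [Field K] (P Q : GL (Fin n) K)
    (M : Matrix (Fin n) (Fin n) K) : frobeniusV P Q M = P.val * M.transpose * Q.val := rfl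

/-- The transpose of a non-singular matrix, as a non-singular matrix. -/
def frobeniusTranspose {n : ℕ} {K : Type*} [Field K] (P : GL (Fin n) K) : GL (Fin n) K where
  val := P.val.transpose
  inv := P.inv.transpose
  val_inv := by rw [← Matrix.transpose_mul, P.inv_val, Matrix.transpose_one]
  inv_val := by rw [← Matrix.transpose_mul, P.val_inv, Matrix.transpose_one]

/-- The Frobenius group
`{u_{P,Q} | P, Q ∈ GL_n(K)} ∪ {v_{P,Q} | P, Q ∈ GL_n(K)}`,
as a subgroup of the group of linear automorphisms of `M_n(K)`. -/
def frobeniusGroup (n : ℕ) (K : Type*) [Field K] :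
    Subgroup (Matrix (Fin n) (Fin n) K ≃ₗ[K] Matrix (Fin n) (Fin n) K) where
  carrier := {w | ∃ P Q : GL (Fin n) K, w = frobeniusU P Q} ∪
    {w | ∃ P Q : GL (Fin n) K, w = frobeniusV P Q}
  one_mem' := by
    refine Or.inl ⟨1, 1, ?_⟩
    ext1 M
    simp [frobeniusU_apply]
  mul_mem' := by
    rintro a b (⟨P, Q, rfl⟩ | ⟨P, Q, rfl⟩) (⟨R, S, rfl⟩ | ⟨R, S, rfl⟩)
    · refine Or.inl ⟨P * R, S * Q, ?_⟩
      ext1 M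
      simp [LinearEquiv.mul_apply, frobeniusU_apply, Matrix.mul_assoc]
    · refine Or.inr ⟨P * R, S * Q, ?_⟩
      ext1 M
      simp [LinearEquiv.mul_apply, frobeniusU_apply, frobeniusV_apply, Matrix.mul_assoc]
    · refine Or.inr ⟨P * frobeniusTranspose S, frobeniusTranspose R * Q, ?_⟩
      ext1 M
      simp [LinearEquiv.mul_apply, frobeniusU_apply, frobeniusV_apply, Matrix.mul_assoc,
        frobeniusTranspose]
    · refine Or.inl ⟨P * frobeniusTranspose S, frobeniusTranspose R * Q, ?_⟩
      ext1 M
      simp [LinearEquiv.mul_apply, frobeniusU_apply, frobeniusV_apply, Matrix.mul_assoc,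
        frobeniusTranspose]
  inv_mem' := by
    rintro a (⟨P, Q, rfl⟩ | ⟨P, Q, rfl⟩)
    · refine Or.inl ⟨P⁻¹, Q⁻¹, ?_⟩
      refine inv_eq_of_mul_eq_one_right ?_
      ext1 M
      exact (frobeniusU P Q).right_inv M
    · refine Or.inr ⟨frobeniusTranspose Q⁻¹, frobeniusTranspose P⁻¹, ?_⟩
      refine inv_eq_of_mul_eq_one_right ?_
      ext1 M
      have h := (frobeniusU P Q).right_inv M
      have h2 : frobeniusV P Q (frobeniusV (frobeniusTranspose Q⁻¹) (frobeniusTranspose P⁻¹) M)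
          = frobeniusU P Q (P.inv * M * Q.inv) := by
        rw [frobeniusV_apply, frobeniusV_apply, frobeniusU_apply]
        simp [Matrix.mul_assoc, frobeniusTranspose]
      exact h2.trans h

/-- The Frobenius group, viewed inside the set of affine endomorphisms of `M_n(K)`. -/
def frobeniusAffineMaps (n : ℕ) (K : Type*) [Field K] :
    Set (Matrix (Fin n) (Fin n) K →ᵃ[K] Matrix (Fin n) (Fin n) K) :=
  {u | ∃ g ∈ frobeniusGroup n K, u = g.toLinearMap.toAffineMap}

/-! The heart of the matter is to show that the linear part `L` of an affine `u` with `IsUnit (u M)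
↔ IsUnit M` preserves rank at most one. `L` is injective, since a kernel element would be a
translation preserving non-singularity, and only zero is.

If `K` has an element besides 0 and 1, rank is read off lines of singular matrices. The determinant
is affine along a rank-one direction, so two singular points on such a line make the whole line
singular. In every direction of rank at least two, some line has singular points exactly at
parameters 0 and 1 (`exists_line_of_not_isOuter`).

If `K` has two elements, `u` preserves the determinant itself, hence the relation `DetFlat`. The
directions flat against a nonzero `x yᵀ` contain a space of dimension `n + 1`, while those flat
against a matrix of rank at least two depend on three entries when `n ≥ 3`. So an injective `L`
cannot raise rank one (`IsOuter.map_of_detFlat`).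

A rank-one preserver is then an equivalence up to transposition, and the translation part vanishes.
For direct images, differences of non-singular matrices span everything, so `u` is bijective and the
image condition becomes the preimage one. -/

/-- A matrix of rank at most one, written as an outer product. -/
def Matrix.IsOuter {m n K : Type*} [Mul K] (A : Matrix m n K) : Prop :=
  ∃ x y, A = Matrix.vecMulVec x y

/-! ### Outer products and linear spaces of matrices of rank at most one -/

namespace Matrix

section Outer

variable {m n K : Type*} [Field K]

theorem vecMulVec_zero_right (x : m → K) : vecMulVec x (0 : n → K) = 0 := by
  ext; simp [vecMulVec_apply]

theorem eq_smul_of_forall_mul_eq {a c : m → K} (ha : a ≠ 0)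
    (h : ∀ i k, a i * c k = a k * c i) : ∃ s : K, c = s • a := by
  obtain ⟨i, hi⟩ := Function.ne_iff.mp ha
  refine ⟨c i / a i, funext fun k => ?_⟩
  have := h i k
  simp only [Pi.zero_apply] at hi
  simp only [Pi.smul_apply, smul_eq_mul]
  field_simp
  linear_combination this

/-- If a sum of two outer products is an outer product, then the left or the right factors are
proportional. -/
theorem IsOuter.proportional {a c : m → K} {b d : n → K} (ha : a ≠ 0) (hb : b ≠ 0)
    (h : (vecMulVec a b + vecMulVec c d).IsOuter) :
    (∃ s : K, c = s • a) ∨ ∃ s : K, d = s • b := by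
  obtain ⟨x, y, hxy⟩ := h
  have e : ∀ i j, a i * b j + c i * d j = x i * y j := fun i j => by
    simpa [vecMulVec_apply] using congrFun (congrFun hxy i) j
  -- Each 2×2 minor of the sum factors as a minor of the columns `a, c` times a minor of the columns
  -- `b, d`.
  have key : ∀ i k j l, (a i * c k - a k * c i) * (b j * d l - b l * d j) = 0 := by
    intro i k j l
    have : (a i * b j + c i * d j) * (a k * b l + c k * d l)
        = (a i * b l + c i * d l) * (a k * b j + c k * d j) := by
      rw [e, e, e, e]; ring
    linear_combination this
  by_cases hac : ∀ i k, a i * c k = a k * c i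
  · exact Or.inl (eq_smul_of_forall_mul_eq ha hac)
  · push Not at hac
    obtain ⟨i, k, hik⟩ := hac
    refine Or.inr (eq_smul_of_forall_mul_eq hb fun j l => ?_)
    exact sub_eq_zero.mp ((mul_eq_zero.mp (key i k j l)).resolve_left (sub_ne_zero.mpr hik))

theorem eq_smul_of_vecMulVec_eq {x z : m → K} {y w : n → K} (hy : y ≠ 0)
    (h : vecMulVec x y = vecMulVec z w) : ∃ s : K, x = s • z := by
  obtain ⟨j, hj⟩ := Function.ne_iff.mp hy
  simp only [Pi.zero_apply] at hj
  refine ⟨w j / y j, funext fun i => ?_⟩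
  have := congrFun (congrFun h i) j
  simp only [vecMulVec_apply] at this
  simp only [Pi.smul_apply, smul_eq_mul]
  field_simp
  linear_combination this

end Outer

end Matrix

theorem Submodule.eq_top_or_eq_top_of_forall_mem {K V : Type*} [Ring K] [AddCommGroup V]
    [Module K V] {U W : Submodule K V} (h : ∀ v, v ∈ U ∨ v ∈ W) : U = ⊤ ∨ W = ⊤ := by
  by_contra! hne
  obtain ⟨u, hu⟩ : ∃ u, u ∉ U := by
    by_contra! hc; exact hne.1 (eq_top_iff.mpr fun v _ => hc v)
  obtain ⟨w, hw⟩ : ∃ w, w ∉ W := by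
    by_contra! hc; exact hne.2 (eq_top_iff.mpr fun v _ => hc v)
  have huW := (h u).resolve_left hu
  have hwU := (h w).resolve_right hw
  rcases h (u + w) with h1 | h1
  · exact hu ((U.add_mem_iff_left hwU).mp h1)
  · exact hw ((W.add_mem_iff_right huW).mp h1)

namespace Matrix

section Outer

variable {m n K V : Type*} [Field K] [AddCommGroup V] [Module K V]

/-- A linear space of matrices of rank at most one has a common left or a common right factor. -/
theorem exists_common_factor (T : V →ₗ[K] Matrix m n K) (hT : ∀ v, (T v).IsOuter) :
    (∃ a, ∀ v, ∃ d, T v = vecMulVec a d) ∨ ∃ b, ∀ v, ∃ c, T v = vecMulVec c b := by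
  by_cases h0 : ∀ v, T v = 0
  · exact Or.inl ⟨0, fun v => ⟨0, by rw [h0, vecMulVec_zero_right]⟩⟩
  push Not at h0
  obtain ⟨v₁, hv₁⟩ := h0
  obtain ⟨a, b, hab⟩ := hT v₁
  have hne : a ≠ 0 ∧ b ≠ 0 := by
    rw [hab] at hv₁
    constructor <;> rintro rfl <;> simp [vecMulVec_zero_right] at hv₁
  let U : Submodule K V :=
    { carrier := {v | ∃ d, T v = vecMulVec a d}
      zero_mem' := ⟨0, by simp [vecMulVec_zero_right]⟩
      add_mem' := by
        rintro v w ⟨d, hd⟩ ⟨e, he⟩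
        exact ⟨d + e, by rw [map_add, hd, he, vecMulVec_add]⟩
      smul_mem' := by
        rintro c v ⟨d, hd⟩
        exact ⟨c • d, by rw [map_smul, hd, vecMulVec_smul]⟩ }
  let W : Submodule K V :=
    { carrier := {v | ∃ d, T v = vecMulVec d b}
      zero_mem' := ⟨0, by simp⟩
      add_mem' := by
        rintro v w ⟨d, hd⟩ ⟨e, he⟩
        exact ⟨d + e, by rw [map_add, hd, he, add_vecMulVec]⟩
      smul_mem' := by
        rintro c v ⟨d, hd⟩
        exact ⟨c • d, by rw [map_smul, hd, smul_vecMulVec]⟩ }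
  have hUW : ∀ v, v ∈ U ∨ v ∈ W := by
    intro v
    obtain ⟨c, d, hcd⟩ := hT v
    have hs : (vecMulVec a b + vecMulVec c d).IsOuter := by
      rw [← hab, ← hcd, ← map_add]; exact hT _
    rcases hs.proportional hne.1 hne.2 with ⟨s, rfl⟩ | ⟨s, rfl⟩
    · exact Or.inl ⟨s • d, by rw [hcd, smul_vecMulVec, vecMulVec_smul]⟩
    · exact Or.inr ⟨s • c, by rw [hcd, smul_vecMulVec, vecMulVec_smul]⟩
  rcases Submodule.eq_top_or_eq_top_of_forall_mem hUW with h | h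
  · exact Or.inl ⟨a, fun v => show v ∈ U from h ▸ Submodule.mem_top⟩
  · exact Or.inr ⟨b, fun v => show v ∈ W from h ▸ Submodule.mem_top⟩

/-- The linear map `y ↦ x yᵀ`. -/
def outerRight (x : m → K) : (n → K) →ₗ[K] Matrix m n K where
  toFun y := vecMulVec x y
  map_add' y z := vecMulVec_add x y z
  map_smul' c y := vecMulVec_smul c x y

theorem outerRight_apply (x : m → K) (y : n → K) : outerRight x y = vecMulVec x y := rfl

/-- The type of common factor cannot depend on `x`. If `x₁` only has a right factor `b` and `x₂`
only a left factor `a`, then adding the two images shows that for each `y` one of them lies on the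
line of `a bᵀ`. One of these two conditions holds for all `y`, which gives `x₁` or `x₂` the missing
factor. -/
theorem left_factors_or_right_factors {p q : Type*}
    (L : Matrix m n K →ₗ[K] Matrix p q K)
    (hO : ∀ A, A.IsOuter → (L A).IsOuter) :
    (∀ x, ∃ a, ∀ y, ∃ d, L (vecMulVec x y) = vecMulVec a d) ∨
      ∀ x, ∃ b, ∀ y, ∃ c, L (vecMulVec x y) = vecMulVec c b := by
  have hx : ∀ x, (∃ a, ∀ y, ∃ d, L (vecMulVec x y) = vecMulVec a d) ∨
      ∃ b, ∀ y, ∃ c, L (vecMulVec x y) = vecMulVec c b := fun x =>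
    exists_common_factor (L.comp (outerRight x)) fun y => hO _ ⟨x, y, rfl⟩
  by_contra! hne
  obtain ⟨⟨x₁, h₁⟩, ⟨x₂, h₂⟩⟩ := hne
  obtain ⟨b, hb⟩ := (hx x₁).resolve_left (by push Not; exact h₁)
  obtain ⟨a, ha⟩ := (hx x₂).resolve_right (by push Not; exact h₂)
  let S : Submodule K (Matrix p q K) := K ∙ vecMulVec a b
  have hcover : ∀ y, y ∈ S.comap (L.comp (outerRight x₁)) ∨
      y ∈ S.comap (L.comp (outerRight x₂)) := by
    intro y
    simp only [Submodule.mem_comap, LinearMap.comp_apply, outerRight_apply]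
    obtain ⟨c, hc⟩ := hb y
    obtain ⟨d, hd⟩ := ha y
    rw [hc, hd]
    by_cases hz : vecMulVec a d = 0
    · rw [hz]; exact Or.inr S.zero_mem
    by_cases hz' : vecMulVec c b = 0
    · rw [hz']; exact Or.inl S.zero_mem
    have ha0 : a ≠ 0 := by rintro rfl; simp at hz
    have hb0 : b ≠ 0 := by rintro rfl; simp [vecMulVec_zero_right] at hz'
    have hs : (vecMulVec a d + vecMulVec c b).IsOuter := by
      rw [← hc, ← hd, ← map_add, ← add_vecMulVec]
      exact hO _ ⟨_, _, rfl⟩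
    have hd0 : d ≠ 0 := by rintro rfl; simp [vecMulVec_zero_right] at hz
    rcases hs.proportional ha0 hd0 with ⟨s, rfl⟩ | ⟨s, hs⟩
    · left; rw [smul_vecMulVec]; exact S.smul_mem _ (Submodule.mem_span_singleton_self _)
    · right
      have hs0 : s ≠ 0 := by rintro rfl; simp at hs; exact hb0 hs
      have : d = s⁻¹ • b := by rw [hs, smul_smul, inv_mul_cancel₀ hs0, one_smul]
      rw [this, vecMulVec_smul]; exact S.smul_mem _ (Submodule.mem_span_singleton_self _)
  rcases Submodule.eq_top_or_eq_top_of_forall_mem hcover with h | h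
  · obtain ⟨y, hy⟩ := h₁ a
    have : y ∈ S.comap (L.comp (outerRight x₁)) := h ▸ Submodule.mem_top
    obtain ⟨s, hs⟩ := Submodule.mem_span_singleton.mp this
    exact hy (s • b) (by rw [vecMulVec_smul]; exact hs.symm)
  · obtain ⟨y, hy⟩ := h₂ b
    have : y ∈ S.comap (L.comp (outerRight x₂)) := h ▸ Submodule.mem_top
    obtain ⟨s, hs⟩ := Submodule.mem_span_singleton.mp this
    exact hy (s • a) (by rw [smul_vecMulVec]; exact hs.symm)

end Outer

/-! ### Injective linear maps preserving rank at most one -/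

section Preserver

variable {n K : Type*} [Fintype n] [DecidableEq n] [Field K]

/-- The right factor of `L (x yᵀ)` turns out to be, up to a scalar depending on `x`, a fixed
automorphism `e` of `y`. This yields `L (x yᵀ) = p(x) e(y)ᵀ` with `p` linear, and rank-one matrices
span. -/
theorem exists_eq_mul_mul_of_left_factors
    (L : Matrix n n K →ₗ[K] Matrix n n K) (hL : Function.Injective L)
    (hO : ∀ A, A.IsOuter → (L A).IsOuter)
    (hleft : ∀ x, ∃ a, ∀ y, ∃ d, L (vecMulVec x y) = vecMulVec a d) :
    ∃ P Q : GL n K, ∀ M, L M = P.val * M * Q.val := by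
  rcases isEmpty_or_nonempty n with hn | hn
  · exact ⟨1, 1, fun M => Subsingleton.elim _ _⟩
  have hL0 : ∀ {x y : n → K}, x ≠ 0 → y ≠ 0 → L (vecMulVec x y) ≠ 0 := fun hx hy h0 =>
    vecMulVec_ne_zero hx hy (hL (h0.trans (map_zero L).symm))
  -- a left factor can be split off linearly
  have split : ∀ x, x ≠ 0 → ∃ a, a ≠ 0 ∧ ∃ f : (n → K) →ₗ[K] (n → K),
      ∀ y, L (vecMulVec x y) = vecMulVec a (f y) := by
    intro x hx
    obtain ⟨a, ha⟩ := hleft x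
    have ha0 : a ≠ 0 := by
      rintro rfl
      obtain ⟨d, hd⟩ := ha 1
      exact hL0 hx one_ne_zero (by rw [hd]; simp)
    obtain ⟨i, hi⟩ := Function.ne_iff.mp ha0
    simp only [Pi.zero_apply] at hi
    refine ⟨a, ha0, (a i)⁻¹ • (LinearMap.proj i ∘ₗ L ∘ₗ outerRight x), fun y => ?_⟩
    obtain ⟨d, hd⟩ := ha y
    rw [hd]
    congr 1
    ext j
    have : (L (vecMulVec x y)) i j = a i * d j := by rw [hd, vecMulVec_apply]
    simp only [LinearMap.smul_apply, LinearMap.comp_apply, LinearMap.proj_apply,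
      Pi.smul_apply, smul_eq_mul]
    erw [this]
    rw [inv_mul_cancel_left₀ hi]
  obtain ⟨a₀, ha₀, f, hf⟩ := split 1 one_ne_zero
  have hfinj : Function.Injective f := by
    rw [← LinearMap.ker_eq_bot, LinearMap.ker_eq_bot']
    intro y hy
    by_contra hy0
    exact hL0 one_ne_zero hy0 (by rw [hf, hy, vecMulVec_zero])
  let e : (n → K) ≃ₗ[K] (n → K) := LinearEquiv.ofInjectiveEndo f hfinj
  have he : ∀ y, L (vecMulVec 1 y) = vecMulVec a₀ (e y) := hf
  have hall : ∀ x, ∃ c, ∀ y, L (vecMulVec x y) = vecMulVec c (e y) := by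
    intro x
    by_cases hx : x = 0
    · exact ⟨0, fun y => by simp [hx]⟩
    obtain ⟨a, ha, g, hg⟩ := split x hx
    by_cases hs : ∃ s : K, a = s • a₀
    · obtain ⟨s, rfl⟩ := hs
      -- With proportional left factors, the image of `x 1ᵀ` is also attained on some `1 zᵀ`, so
      -- injectivity makes `x` a multiple of the all-ones vector.
      have h1 : L (vecMulVec x 1) = L (vecMulVec 1 (e.symm (s • g 1))) := by
        rw [hg, he, e.apply_symm_apply, smul_vecMulVec, vecMulVec_smul]
      obtain ⟨t, rfl⟩ := eq_smul_of_vecMulVec_eq one_ne_zero (hL h1)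
      exact ⟨t • a₀, fun y => by rw [smul_vecMulVec, map_smul, he, smul_vecMulVec]⟩
    · have hprop : ∀ y, ∃ s : K, g y = s • e y := by
        intro y
        by_cases hy : y = 0
        · exact ⟨0, by simp [hy]⟩
        refine (IsOuter.proportional ha₀ (e.map_ne_zero_iff.mpr hy) ?_).resolve_left hs
        rw [← he, ← hg, ← map_add, ← add_vecMulVec]
        exact hO _ ⟨_, _, rfl⟩
      -- Every vector is an eigenvector of `g ∘ e⁻¹`, which is therefore a scalar.
      obtain ⟨s, hs'⟩ := (g ∘ₗ e.symm.toLinearMap).exists_eq_smul_id_of_forall_notLinearIndependent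
        (fun v hv => by
          obtain ⟨s, hs⟩ := hprop (e.symm v)
          rw [e.apply_symm_apply] at hs
          have := LinearIndependent.pair_iff.mp hv s (-1) (by simp [hs])
          simp at this)
      refine ⟨s • a, fun y => ?_⟩
      have := LinearMap.congr_fun hs' (e y)
      simp only [LinearMap.comp_apply, LinearEquiv.coe_coe, e.symm_apply_apply,
        LinearMap.smul_apply, Module.End.one_apply] at this
      rw [hg, this, smul_vecMulVec, vecMulVec_smul]
  obtain ⟨j, hj⟩ := Function.ne_iff.mp (e.map_ne_zero_iff.mpr (one_ne_zero : (1 : n → K) ≠ 0))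
  simp only [Pi.zero_apply] at hj
  let p : (n → K) →ₗ[K] (n → K) :=
    { toFun := fun x i => L (vecMulVec x 1) i j / e 1 j
      map_add' := fun x y => by ext i; simp [add_div]
      map_smul' := fun c x => by ext i; simp [mul_div_assoc] }
  have hp : ∀ x y, L (vecMulVec x y) = vecMulVec (p x) (e y) := by
    intro x y
    obtain ⟨c, hc⟩ := hall x
    have : p x = c := by
      ext i
      change L (vecMulVec x 1) i j / e 1 j = c i
      rw [hc, vecMulVec_apply, mul_div_cancel_right₀ _ hj]
    rw [this, hc]
  let A : Matrix n n K := LinearMap.toMatrix' p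
  let B : Matrix n n K := (LinearMap.toMatrix' e.toLinearMap)ᵀ
  have hLM : ∀ M, L M = A * M * B := by
    have : L = LinearMap.mulRight K B ∘ₗ LinearMap.mulLeft K A := by
      refine Matrix.ext_linearMap K fun i j => LinearMap.ext_ring ?_
      simp only [LinearMap.comp_apply, singleLinearMap_apply, LinearMap.mulRight_apply,
        LinearMap.mulLeft_apply]
      rw [single_eq_single_vecMulVec_single, hp, mul_vecMulVec, vecMulVec_mul, vecMul_transpose,
        LinearMap.toMatrix'_mulVec, LinearMap.toMatrix'_mulVec]
      rfl
    intro M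
    rw [this]; rfl
  obtain ⟨M, hM⟩ := (LinearMap.injective_iff_surjective.mp hL) 1
  rw [hLM] at hM
  have hA : IsUnit A := by
    rw [Matrix.mul_assoc] at hM
    exact IsUnit.of_mul_eq_one _ hM
  have hB : IsUnit B := IsUnit.of_mul_eq_one_right _ hM
  exact ⟨hA.unit, hB.unit, hLM⟩

/-- An injective linear endomorphism of `M_n(K)` that preserves the matrices of rank at most one
is an equivalence, possibly after a transposition. -/
theorem exists_eq_mul_mul_or_eq_mul_transpose_mul
    (L : Matrix n n K →ₗ[K] Matrix n n K) (hL : Function.Injective L)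
    (hO : ∀ A, A.IsOuter → (L A).IsOuter) :
    (∃ P Q : GL n K, ∀ M, L M = P.val * M * Q.val) ∨
      ∃ P Q : GL n K, ∀ M, (L M)ᵀ = P.val * M * Q.val := by
  rcases left_factors_or_right_factors L hO with h | h
  · exact Or.inl (exists_eq_mul_mul_of_left_factors L hL hO h)
  · refine Or.inr (exists_eq_mul_mul_of_left_factors
      ((transposeLinearEquiv n n K K).toLinearMap ∘ₗ L)
      ((transposeLinearEquiv n n K K).injective.comp hL) ?_ ?_)
    · intro A hA
      obtain ⟨x, y, hxy⟩ := hO A hA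
      exact ⟨y, x, by simp [hxy, transpose_vecMulVec]⟩
    · intro x
      obtain ⟨b, hb⟩ := h x
      refine ⟨b, fun y => ?_⟩
      obtain ⟨c, hc⟩ := hb y
      exact ⟨c, by simp [hc, transpose_vecMulVec]⟩

end Preserver

end Matrix

namespace Matrix

theorem IsOuter.mul_mul {n K : Type*} [Fintype n] [Field K] {A : Matrix n n K} (h : A.IsOuter) (P Q : Matrix n n K) :
    (P * A * Q).IsOuter := by
  obtain ⟨x, y, rfl⟩ := h
  exact ⟨P *ᵥ x, y ᵥ* Q, by rw [mul_vecMulVec, vecMulVec_mul]⟩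

/-! ### Singular matrices on lines -/

section Diagonal

variable {n K : Type*} [Fintype n] [DecidableEq n] [Field K]

/-- Every square matrix over a field is equivalent to a diagonal one. -/
theorem exists_eq_mul_diagonal_mul (N : Matrix n n K) :
    ∃ (P Q : GL n K) (d : n → K), N = P.val * diagonal d * Q.val := by
  obtain ⟨L, L', d, h⟩ := Pivot.exists_list_transvec_mul_diagonal_mul_list_transvec N
  have hu : ∀ L : List (TransvectionStruct n K),
      IsUnit (L.map TransvectionStruct.toMatrix).prod := fun L => by
    rw [isUnit_iff_isUnit_det, TransvectionStruct.det_toMatrix_prod]; exact isUnit_one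
  exact ⟨(hu L).unit, (hu L').unit, d, h⟩

theorem exists_two_ne_zero_of_not_isOuter_diagonal [Nonempty n] {d : n → K}
    (h : ¬ (diagonal d).IsOuter) : ∃ i j, i ≠ j ∧ d i ≠ 0 ∧ d j ≠ 0 := by
  by_contra! hd
  by_cases h0 : ∃ i, d i ≠ 0
  · obtain ⟨i, hi⟩ := h0
    refine h ⟨Pi.single i (d i), Pi.single i 1, ?_⟩
    have : d = Pi.single i (d i) := by
      ext j
      by_cases hij : i = j
      · subst hij; simp
      · rw [Pi.single_eq_of_ne (Ne.symm hij)]; exact hd i j hij hi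
    ext k l
    rw [vecMulVec_apply, ← this, diagonal_apply, Pi.single_apply]
    split_ifs with h1 h2 h2
    · simp
    · rw [hd i k (fun e => h2 (by rw [← h1, e])) hi, zero_mul]
    · rw [this, Pi.single_eq_of_ne (fun e => h1 (e.trans h2.symm)), zero_mul]
    · simp
  · push Not at h0
    exact h ⟨0, 0, by rw [show d = 0 from funext h0]; simp⟩

theorem isUnit_mul_mul_iff (P Q : GL n K) (M : Matrix n n K) :
    IsUnit (P.val * M * Q.val) ↔ IsUnit M := by
  rw [Units.isUnit_mul_units, Units.isUnit_units_mul]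

/-- The only translation of `M_n(K)` that preserves non-singularity is the identity. -/
theorem eq_zero_of_forall_isUnit_add_iff {C : Matrix n n K}
    (h : ∀ M, IsUnit (M + C) ↔ IsUnit M) : C = 0 := by
  classical
  obtain ⟨P, Q, d, rfl⟩ := exists_eq_mul_diagonal_mul C
  -- Ones exactly where `d` vanishes: adding `d` makes this diagonal invertible, so it is already
  -- invertible and `d` has no nonzero entry.
  have h1 := h (P.val * diagonal (fun i => if d i = 0 then 1 else 0) * Q.val)
  rw [← add_mul, ← mul_add, isUnit_mul_mul_iff, isUnit_mul_mul_iff, diagonal_add,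
    isUnit_diagonal, isUnit_diagonal, Pi.isUnit_iff, Pi.isUnit_iff] at h1
  have h2 : d = 0 := by
    ext i
    by_contra hi
    have := h1.mp (fun j => by by_cases hj : d j = 0 <;> simp [hj]) i
    simp only [Pi.zero_apply] at hi
    simp [hi] at this
  simp [h2]

/-- In the direction of a matrix of rank at least two there is a line with exactly two singular
matrices. -/
theorem exists_line_of_not_isOuter [Nonempty n] {N : Matrix n n K} (h : ¬ N.IsOuter) :
    ∃ M, ¬ IsUnit M ∧ ¬ IsUnit (M + N) ∧
      ∀ c : K, c ≠ 0 → c ≠ 1 → IsUnit (M + c • N) := by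
  classical
  obtain ⟨P, Q, d, rfl⟩ := exists_eq_mul_diagonal_mul N
  obtain ⟨i, j, hij, hi, hj⟩ := exists_two_ne_zero_of_not_isOuter_diagonal
    (fun hd => h (hd.mul_mul P.val Q.val))
  -- On the line `m + c d`, entry `i` vanishes only at `c = 0`, entry `j` only at `c = 1`, and zeros
  -- of `d` are filled with ones.
  let m : n → K := fun k => if k = j then - d j else if d k = 0 then 1 else 0
  refine ⟨P.val * diagonal m * Q.val, ?_, ?_, fun c hc0 hc1 => ?_⟩
  · rw [isUnit_mul_mul_iff, isUnit_diagonal, Pi.isUnit_iff]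
    intro hm
    have := hm i
    simp [m, hij, hi] at this
  · rw [← add_mul, ← mul_add, isUnit_mul_mul_iff, diagonal_add, isUnit_diagonal, Pi.isUnit_iff]
    intro hm
    have := hm j
    simp [m] at this
  · rw [← smul_mul_assoc, ← mul_smul_comm, ← add_mul, ← mul_add, isUnit_mul_mul_iff,
      ← diagonal_smul, diagonal_add, isUnit_diagonal, Pi.isUnit_iff]
    intro k
    rw [isUnit_iff_ne_zero]
    by_cases hk : k = j
    · subst hk
      have : (c - 1) * d k ≠ 0 := mul_ne_zero (sub_ne_zero.mpr hc1) hj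
      simp only [m, if_true, Pi.smul_apply, smul_eq_mul]
      intro e; apply this; linear_combination e
    · by_cases hdk : d k = 0 <;> simp [m, hk, hdk, hc0]

/-- The determinant is an affine function of `w` along `M + x wᵀ`. -/
theorem exists_det_add_vecMulVec (M : Matrix n n K) (x : n → K) :
    ∃ f : (n → K) →ₗ[K] K, ∀ w, (M + vecMulVec x w).det = M.det + f w := by
  -- By the Schur complement, `det (M + x wᵀ)` is the determinant of `M` bordered by the column `x`,
  -- the row `-w` and the corner 1; it is affine in that row.
  let Z : Matrix (n ⊕ Unit) (n ⊕ Unit) K := fromBlocks M (replicateCol Unit x) 0 1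
  let g : (n → K) →ₗ[K] (n ⊕ Unit → K) :=
    { toFun := fun w => Sum.elim (-w) 0
      map_add' := fun v w => by ext (i | i) <;> simp [add_comm]
      map_smul' := fun c w => by ext (i | i) <;> simp }
  refine ⟨detRowAlternating.toMultilinearMap.toLinearMap Z (Sum.inr ()) ∘ₗ g, fun w => ?_⟩
  have h1 : (M + vecMulVec x w).det = (updateRow Z (Sum.inr ()) (Sum.elim (-w) 1)).det := by
    have : updateRow Z (Sum.inr ()) (Sum.elim (-w) 1)
        = fromBlocks M (replicateCol Unit x) (replicateRow Unit (-w)) 1 := by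
      ext (i | i) (j | j) <;> simp [Z, updateRow_apply]
    rw [this, det_fromBlocks_one₂₂, ← vecMulVec_eq, vecMulVec_neg, sub_neg_eq_add]
  have h2 : M.det = (updateRow Z (Sum.inr ()) (Sum.elim 0 1)).det := by
    have : updateRow Z (Sum.inr ()) (Sum.elim 0 1)
        = fromBlocks M (replicateCol Unit x) 0 1 := by
      ext (i | i) (j | j) <;> simp [Z, updateRow_apply]
    rw [this, det_fromBlocks_one₂₂]; simp
  have h3 : Sum.elim (-w) 1 = (Sum.elim 0 1 : n ⊕ Unit → K) + g w := by
    ext (i | i) <;> simp [g]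
  rw [h1, h3, det_updateRow_add, ← h2]
  rfl

/-- A line in the direction of a matrix of rank at most one that contains two singular matrices
consists of singular matrices. -/
theorem IsOuter.not_isUnit_add_smul {N : Matrix n n K} (hN : N.IsOuter) {M : Matrix n n K}
    (h₀ : ¬ IsUnit M) (h₁ : ¬ IsUnit (M + N)) (c : K) : ¬ IsUnit (M + c • N) := by
  obtain ⟨x, y, rfl⟩ := hN
  obtain ⟨f, hf⟩ := exists_det_add_vecMulVec M x
  rw [isUnit_iff_isUnit_det, isUnit_iff_ne_zero, not_not] at h₀ h₁ ⊢
  rw [hf, h₀, zero_add] at h₁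
  rw [← vecMulVec_smul, hf, map_smul, h₀, h₁]
  simp

end Diagonal

/-! ### Second differences of the determinant -/

section SecondDifference

variable {n K : Type*} [Fintype n] [DecidableEq n] [Field K]

/-- The second difference of the determinant in the directions `N` and `B` vanishes identically. -/
def DetFlat (N B : Matrix n n K) : Prop :=
  ∀ M : Matrix n n K, (M + N + B).det - (M + N).det - (M + B).det + M.det = 0

theorem DetFlat.add {N B C : Matrix n n K} (hB : DetFlat N B) (hC : DetFlat N C) :
    DetFlat N (B + C) := by
  intro M
  have h1 := hB M
  have h2 := hC (M + B)
  rw [add_right_comm M B N] at h2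
  rw [← add_assoc, ← add_assoc]
  linear_combination h1 + h2

theorem DetFlat.transpose {N B : Matrix n n K} (h : DetFlat N B) : DetFlat Nᵀ Bᵀ := by
  intro M
  have := h Mᵀ
  rw [← det_transpose, ← det_transpose (Mᵀ + N), ← det_transpose (Mᵀ + B), det_transpose M] at this
  simpa using this

theorem DetFlat.of_mul_mul {P Q : GL n K} {N B : Matrix n n K}
    (h : DetFlat (P.val * N * Q.val) (P.val * B * Q.val)) : DetFlat N B := by
  intro M
  have := h (P.val * M * Q.val)
  simp only [← add_mul, ← mul_add, det_mul] at this
  have hP : P.val.det ≠ 0 := isUnit_iff_ne_zero.mp ((isUnit_iff_isUnit_det _).mp P.isUnit)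
  have hQ : Q.val.det ≠ 0 := isUnit_iff_ne_zero.mp ((isUnit_iff_isUnit_det _).mp Q.isUnit)
  refine mul_left_cancel₀ (mul_ne_zero hP hQ) ?_
  linear_combination this

theorem detFlat_vecMulVec_right (x y z : n → K) : DetFlat (vecMulVec x y) (vecMulVec x z) := by
  intro M
  obtain ⟨f, hf⟩ := exists_det_add_vecMulVec M x
  rw [add_assoc M, ← vecMulVec_add, hf, hf, hf, map_add]
  ring

theorem detFlat_vecMulVec_left (x y z : n → K) : DetFlat (vecMulVec x y) (vecMulVec z y) := by
  simpa [transpose_vecMulVec] using (detFlat_vecMulVec_right y x z).transpose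

end SecondDifference

/-! ### Flat directions and the dimension count -/

section Minors

variable {K : Type*} [Field K]

theorem det_add_single {n : ℕ} (M : Matrix (Fin (n + 1)) (Fin (n + 1)) K) (a b : Fin (n + 1)) :
    (M + single a b 1).det
      = M.det + (-1) ^ (a + b : ℕ) * (M.submatrix a.succAbove b.succAbove).det := by
  have h : M + single a b 1 = updateRow M a (M a + Pi.single b 1) := by
    ext i j
    by_cases hi : i = a
    · subst hi; simp [single_apply, Pi.single_apply, eq_comm]
    · simp [hi, Ne.symm hi]
  rw [h, det_updateRow_add, updateRow_eq_self, ← adjugate_apply,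
    adjugate_fin_succ_eq_det_submatrix]

/-- Replacing `M` by `M + single a b 1` changes each determinant by a signed complementary minor, so
subtracting two flatness identities leaves the one for the minors. -/
theorem DetFlat.submatrix_succAbove {n : ℕ} {N B : Matrix (Fin (n + 1)) (Fin (n + 1)) K}
    (h : DetFlat N B) (a b : Fin (n + 1)) :
    DetFlat (N.submatrix a.succAbove b.succAbove) (B.submatrix a.succAbove b.succAbove) := by
  intro M
  let M' : Matrix (Fin (n + 1)) (Fin (n + 1)) K :=
    Fin.insertNth (α := fun _ => Fin (n + 1) → K) a 0 fun i => b.insertNth 0 (M i)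
  have hM : M'.submatrix a.succAbove b.succAbove = M := by
    ext i j
    rw [submatrix_apply]
    change (Fin.insertNth (α := fun _ => Fin (n + 1) → K) a 0 (fun i => b.insertNth 0 (M i))
      (a.succAbove i) : Fin (n + 1) → K) (b.succAbove j) = M i j
    rw [Fin.insertNth_apply_succAbove, Fin.insertNth_apply_succAbove]
  have h1 := h M'
  have h2 := h (M' + single a b 1)
  rw [add_right_comm M' _ N, add_right_comm M' _ B, add_right_comm (M' + N) _ B,
    det_add_single, det_add_single, det_add_single, det_add_single] at h2
  simp only [submatrix_add, Pi.add_apply, hM] at h2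
  refine mul_left_cancel₀
    (pow_ne_zero (a + b : ℕ) (neg_ne_zero.mpr (one_ne_zero : (1 : K) ≠ 0))) ?_
  linear_combination h2 - h1

/-- Rows and columns other than `i, k` and `j, l` are deleted until size two, where the second
difference is the polar form of the quadratic form `det`. -/
theorem DetFlat.minor_eq_zero {n : ℕ} (hn : 2 ≤ n) {N B : Matrix (Fin n) (Fin n) K}
    (h : DetFlat N B) {i k j l : Fin n} (hik : i ≠ k) (hjl : j ≠ l) :
    N i j * B k l + N k l * B i j - N i l * B k j - N k j * B i l = 0 := by
  induction n, hn using Nat.le_induction with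
  | base =>
    have := h 0
    simp only [zero_add, det_fin_two, add_apply, zero_apply] at this
    fin_cases i <;> fin_cases k <;> fin_cases j <;> fin_cases l <;> simp at hik hjl ⊢ <;>
      first
      | linear_combination this
      | linear_combination -this
  | succ n hn ih =>
    obtain ⟨a, hai, hak⟩ := Fin.exists_ne_and_ne_of_two_lt i k (by omega)
    obtain ⟨b, hbj, hbl⟩ := Fin.exists_ne_and_ne_of_two_lt j l (by omega)
    obtain ⟨i, rfl⟩ := Fin.exists_succAbove_eq hai.symm
    obtain ⟨k, rfl⟩ := Fin.exists_succAbove_eq hak.symm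
    obtain ⟨j, rfl⟩ := Fin.exists_succAbove_eq hbj.symm
    obtain ⟨l, rfl⟩ := Fin.exists_succAbove_eq hbl.symm
    exact ih (h.submatrix_succAbove a b) (fun e => hik (by rw [e])) (fun e => hjl (by rw [e]))

/-- A direction `B` along which the differences of the determinant in the direction of a diagonal
matrix of rank at least two are constant is determined by three of its entries. -/
theorem DetFlat.eq_zero_of_diagonal {n : ℕ} (hn : 3 ≤ n) {d : Fin n → K}
    {B : Matrix (Fin n) (Fin n) K} (h : DetFlat (diagonal d) B) {i j : Fin n} (hij : i ≠ j)
    (hi : d i ≠ 0) (hj : d j ≠ 0) (hii : B i i = 0) (hBij : B i j = 0) (hji : B j i = 0) :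
    B = 0 := by
  have off : ∀ m k l, d m ≠ 0 → k ≠ l → m ≠ k → m ≠ l → B k l = 0 := by
    intro m k l hm hkl hmk hml
    have := h.minor_eq_zero (by omega) hmk hml
    rw [diagonal_apply_eq, diagonal_apply_ne _ hkl, diagonal_apply_ne _ hml,
      diagonal_apply_ne _ hmk.symm] at this
    refine mul_left_cancel₀ hm ?_
    linear_combination this
  ext k l
  rw [zero_apply]
  by_cases hkl : k = l
  · subst hkl
    by_cases hik : i = k
    · rw [← hik, hii]
    have := h.minor_eq_zero (by omega) hik hik
    rw [diagonal_apply_eq, diagonal_apply_eq, diagonal_apply_ne _ hik,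
      diagonal_apply_ne _ (Ne.symm hik), hii] at this
    refine mul_left_cancel₀ hi ?_
    linear_combination this
  · by_cases h1 : i ≠ k ∧ i ≠ l
    · exact off i k l hi hkl h1.1 h1.2
    by_cases h2 : j ≠ k ∧ j ≠ l
    · exact off j k l hj hkl h2.1 h2.2
    have : (k = i ∧ l = j) ∨ (k = j ∧ l = i) := by grind
    rcases this with ⟨rfl, rfl⟩ | ⟨rfl, rfl⟩
    · exact hBij
    · exact hji

/-- A linear bijection that preserves the flatness relation preserves the matrices of rank at most
one. -/
theorem IsOuter.map_of_detFlat {n : ℕ} (hn : 3 ≤ n)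
    (L : Matrix (Fin n) (Fin n) K →ₗ[K] Matrix (Fin n) (Fin n) K) (hL : Function.Injective L)
    (hflat : ∀ N B, DetFlat N B → DetFlat (L N) (L B))
    {N : Matrix (Fin n) (Fin n) K} (hN : N.IsOuter) : (L N).IsOuter := by
  have : Nonempty (Fin n) := ⟨⟨0, by omega⟩⟩
  by_contra hLN
  obtain ⟨x, y, rfl⟩ := hN
  have hxy : x ≠ 0 ∧ y ≠ 0 := by
    constructor <;> rintro rfl <;> exact hLN ⟨0, 0, by simp⟩
  obtain ⟨w, hw⟩ := exists_linearIndependent_pair_of_one_lt_finrank (R := K)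
    (by rw [Module.finrank_fin_fun]; omega) hxy.1
  obtain ⟨P, Q, d, hd⟩ := exists_eq_mul_diagonal_mul (L (vecMulVec x y))
  obtain ⟨i, j, hij, hi, hj⟩ := exists_two_ne_zero_of_not_isOuter_diagonal
    (d := d) (fun hd' => hLN (hd ▸ hd'.mul_mul P.val Q.val))
  -- The directions `x zᵀ + t w yᵀ` are flat against `x yᵀ` and, as `x` and `w` are independent,
  -- form a space of dimension `n + 1 ≥ 4`. Flatness of their images against `diagonal d` would make
  -- the three entries read by `E` determine them.
  let T : (Fin n → K) × K →ₗ[K] Matrix (Fin n) (Fin n) K :=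
    (frobeniusU P Q).symm.toLinearMap ∘ₗ L ∘ₗ
      ((outerRight x).coprod (LinearMap.toSpanSingleton K _ (vecMulVec w y)))
  have hT : ∀ z t, P.val * T (z, t) * Q.val = L (vecMulVec x z + vecMulVec (t • w) y) := by
    intro z t
    rw [← frobeniusU_apply]
    simp only [T, LinearMap.comp_apply, LinearEquiv.coe_coe, LinearEquiv.apply_symm_apply,
      LinearMap.coprod_apply, outerRight_apply, LinearMap.toSpanSingleton_apply, smul_vecMulVec]
  let E : Matrix (Fin n) (Fin n) K →ₗ[K] (Fin 3 → K) :=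
    LinearMap.pi ![entryLinearMap K K i i, entryLinearMap K K i j, entryLinearMap K K j i]
  have hinj : Function.Injective (E ∘ₗ T) := by
    rw [← LinearMap.ker_eq_bot, LinearMap.ker_eq_bot']
    rintro ⟨z, t⟩ hzt
    have hflat' : DetFlat (diagonal d) (T (z, t)) := by
      apply DetFlat.of_mul_mul (P := P) (Q := Q)
      rw [← hd, hT]
      exact hflat _ _ ((detFlat_vecMulVec_right x y z).add (detFlat_vecMulVec_left x y (t • w)))
    have hT0 : T (z, t) = 0 := hflat'.eq_zero_of_diagonal hn hij hi hj
      (congrFun hzt 0) (congrFun hzt 1) (congrFun hzt 2)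
    have h0 : vecMulVec x z + vecMulVec (t • w) y = 0 := by
      apply hL
      rw [← hT, hT0]; simp
    have hxz : ∀ k l, z l * x k + (t * y l) * w k = 0 := fun k l => by
      have := congrFun (congrFun h0 k) l
      simp only [add_apply, vecMulVec_apply, Pi.smul_apply, smul_eq_mul, zero_apply] at this
      linear_combination this
    have hzl : ∀ l, z l = 0 ∧ t * y l = 0 := fun l =>
      LinearIndependent.pair_iff.mp hw _ _ (funext fun k => by simpa using hxz k l)
    obtain ⟨l, hl⟩ := Function.ne_iff.mp hxy.2
    exact Prod.ext (funext fun l => (hzl l).1) ((mul_eq_zero.mp (hzl l).2).resolve_right hl)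
  have := LinearMap.finrank_le_finrank_of_injective hinj
  simp at this
  omega

end Minors

end Matrix

/-! ### Affine maps preserving non-singularity -/

theorem isUnit_frobeniusGroup_apply_iff {n : ℕ} {K : Type*} [Field K]
    {g : Matrix (Fin n) (Fin n) K ≃ₗ[K] Matrix (Fin n) (Fin n) K} (hg : g ∈ frobeniusGroup n K)
    (M : Matrix (Fin n) (Fin n) K) : IsUnit (g M) ↔ IsUnit M := by
  rcases hg with ⟨P, Q, rfl⟩ | ⟨P, Q, rfl⟩
  · rw [frobeniusU_apply, Matrix.isUnit_mul_mul_iff]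
  · rw [frobeniusV_apply, Matrix.isUnit_mul_mul_iff, Matrix.isUnit_transpose]

theorem exists_ne_zero_ne_one_of_two_lt_card {K : Type*} [Field K] (h : 2 < ENat.card K) :
    ∃ c : K, c ≠ 0 ∧ c ≠ 1 := by
  by_contra! hc
  refine h.not_ge ?_
  rw [← Set.encard_univ]
  refine (Set.encard_le_encard (t := {0, 1}) fun c _ => ?_).trans 
    ((Set.encard_insert_le {1} 0).trans (by rw [Set.encard_singleton, one_add_one_eq_two]))
  by_cases h0 : c = 0
  · exact Or.inl h0
  · exact Or.inr (hc c h0)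

section Preserver

variable {K : Type*} [Field K] {n : ℕ}
  {u : Matrix (Fin n) (Fin n) K →ᵃ[K] Matrix (Fin n) (Fin n) K}

open Matrix

theorem AffineMap.map_add_eq_add_linear (M N : Matrix (Fin n) (Fin n) K) :
    u (M + N) = u M + u.linear N := by
  have := u.map_vadd M N
  rw [vadd_eq_add, vadd_eq_add] at this
  rw [add_comm, this, add_comm]

theorem linear_injective_of_isUnit_iff (hu : ∀ M, IsUnit (u M) ↔ IsUnit M) :
    Function.Injective u.linear := by
  rw [← LinearMap.ker_eq_bot, LinearMap.ker_eq_bot']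
  intro C hC
  refine eq_zero_of_forall_isUnit_add_iff fun M => ?_
  rw [← hu, AffineMap.map_add_eq_add_linear, hC, add_zero, hu]

theorem surjective_of_linear_injective (hu : Function.Injective u.linear) :
    Function.Surjective u :=
  u.linear_surjective_iff.mp (LinearMap.injective_iff_surjective.mp hu)

/-- Over a field with more than two elements, the linear part of an affine map that preserves
non-singularity in both directions preserves the matrices of rank at most one. -/
theorem isOuter_linear_of_ne (hn : 0 < n) (hu : ∀ M, IsUnit (u M) ↔ IsUnit M) {c : K}
    (hc0 : c ≠ 0) (hc1 : c ≠ 1) {N : Matrix (Fin n) (Fin n) K} (hN : N.IsOuter) :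
    (u.linear N).IsOuter := by
  have : Nonempty (Fin n) := ⟨⟨0, hn⟩⟩
  by_contra hLN
  obtain ⟨M', h0, h1, hc⟩ := exists_line_of_not_isOuter hLN
  obtain ⟨M, rfl⟩ := surjective_of_linear_injective (linear_injective_of_isUnit_iff hu) M'
  have h2 := hc c hc0 hc1
  rw [← AffineMap.map_add_eq_add_linear] at h1
  rw [← map_smul, ← AffineMap.map_add_eq_add_linear] at h2
  rw [hu] at h0 h1 h2
  exact hN.not_isUnit_add_smul h0 h1 c h2

theorem detFlat_linear_of_det_eq (hu : Function.Surjective u) (hdet : ∀ M, (u M).det = M.det)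
    {N B : Matrix (Fin n) (Fin n) K} (h : DetFlat N B) : DetFlat (u.linear N) (u.linear B) := by
  intro M'
  obtain ⟨M, rfl⟩ := hu M'
  simp only [← AffineMap.map_add_eq_add_linear, hdet]
  exact h M

theorem det_eq_of_isUnit_iff (hK : ∀ c : K, c ≠ 0 → c = 1) (hu : ∀ M, IsUnit (u M) ↔ IsUnit M)
    (M : Matrix (Fin n) (Fin n) K) : (u M).det = M.det := by
  have h := hu M
  rw [isUnit_iff_isUnit_det, isUnit_iff_isUnit_det, isUnit_iff_ne_zero, isUnit_iff_ne_zero] at h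
  by_cases h0 : M.det = 0
  · rw [h0]; by_contra h1; exact h.mp h1 h0
  · rw [hK _ h0, hK _ (h.mpr h0)]

theorem isOuter_linear (hn : 0 < n) (h : n ≠ 2 ∨ 2 < ENat.card K)
    (hu : ∀ M, IsUnit (u M) ↔ IsUnit M) {N : Matrix (Fin n) (Fin n) K} (hN : N.IsOuter) :
    (u.linear N).IsOuter := by
  by_cases hK : ∃ c : K, c ≠ 0 ∧ c ≠ 1
  · obtain ⟨c, hc0, hc1⟩ := hK
    exact isOuter_linear_of_ne hn hu hc0 hc1 hN
  have hn2 : n ≠ 2 := h.resolve_right fun h' => hK (exists_ne_zero_ne_one_of_two_lt_card h')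
  push Not at hK
  rcases (by omega : n = 1 ∨ 3 ≤ n) with rfl | hn3
  · exact ⟨fun i => u.linear N i 0, 1, by ext i j; simp [vecMulVec_apply, Subsingleton.elim j 0]⟩
  · have hinj := linear_injective_of_isUnit_iff hu
    exact hN.map_of_detFlat hn3 u.linear hinj fun N B =>
      detFlat_linear_of_det_eq (surjective_of_linear_injective hinj) (det_eq_of_isUnit_iff hK hu)

theorem mem_frobeniusAffineMaps_of_isUnit_iff (hn : 0 < n) (h : n ≠ 2 ∨ 2 < ENat.card K)
    (hu : ∀ M, IsUnit (u M) ↔ IsUnit M) : u ∈ frobeniusAffineMaps n K := by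
  have hlin : ∃ g ∈ frobeniusGroup n K, ∀ M, u.linear M = g M := by
    rcases exists_eq_mul_mul_or_eq_mul_transpose_mul u.linear (linear_injective_of_isUnit_iff hu)
      (fun A hA => isOuter_linear hn h hu hA) with ⟨P, Q, hPQ⟩ | ⟨P, Q, hPQ⟩
    · exact ⟨frobeniusU P Q, Or.inl ⟨P, Q, rfl⟩, hPQ⟩
    · refine ⟨frobeniusV (frobeniusTranspose Q) (frobeniusTranspose P), Or.inr ⟨_, _, rfl⟩,
        fun M => ?_⟩
      rw [frobeniusV_apply, ← transpose_transpose (u.linear M), hPQ, transpose_mul, transpose_mul,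
        ← mul_assoc]
      rfl
  obtain ⟨g, hg, hgu⟩ := hlin
  have hu' : ∀ M, u M = g M + u 0 := fun M => by
    rw [← hgu, add_comm, ← AffineMap.map_add_eq_add_linear, zero_add]
  -- Composing `u` with `g⁻¹` leaves a translation that preserves non-singularity.
  have h0 : g.symm (u 0) = 0 := eq_zero_of_forall_isUnit_add_iff fun M => by
    rw [← isUnit_frobeniusGroup_apply_iff hg, map_add, g.apply_symm_apply, ← hu', hu]
  rw [LinearEquiv.map_eq_zero_iff] at h0
  refine ⟨g, hg, AffineMap.ext fun M => ?_⟩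
  rw [hu', h0, add_zero]
  rfl

/-- A subspace that contains all differences of non-singular matrices is the whole of `M_n(K)`,
except when `M_n(K)` has two elements. -/
theorem eq_top_of_forall_isUnit_sub_mem (hn : 0 < n) (h : 1 < n ∨ 2 < ENat.card K)
    {R : Submodule K (Matrix (Fin n) (Fin n) K)}
    (hR : ∀ M N, IsUnit M → IsUnit N → M - N ∈ R) : R = ⊤ := by
  rcases (by omega : n = 1 ∨ 1 < n) with rfl | hn1
  · obtain ⟨c, hc0, hc1⟩ := exists_ne_zero_ne_one_of_two_lt_card (h.resolve_left (lt_irrefl 1))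
    refine eq_top_iff.mpr fun M _ => ?_
    have hc : IsUnit (c • (1 : Matrix (Fin 1) (Fin 1) K)) := by
      rw [isUnit_iff_isUnit_det]; simpa using hc0
    have := R.smul_mem (M 0 0 / (c - 1)) (hR _ _ hc isUnit_one)
    convert this using 1
    ext i j
    have hc1' : c - 1 ≠ 0 := sub_ne_zero.mpr hc1
    simp [Subsingleton.elim i 0, Subsingleton.elim j 0, hc1']
  have htr : ∀ i j (c : K), i ≠ j → IsUnit (transvection i j c : Matrix (Fin n) (Fin n) K) := by
    intro i j c hij
    rw [isUnit_iff_isUnit_det, det_transvection_of_ne i j hij]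
    exact isUnit_one
  -- This is the difference between a transvection times `M` and `M`; taking `M = 1`, then `M` a
  -- transvection, reaches the off-diagonal and then the diagonal matrix units.
  have hmul : ∀ i j (c : K) (M : Matrix (Fin n) (Fin n) K), i ≠ j → IsUnit M →
      single i j c * M ∈ R := by
    intro i j c M hij hM
    have := hR _ _ ((htr i j c hij).mul hM) hM
    rwa [transvection, add_mul, one_mul, add_sub_cancel_left] at this
  have hoff : ∀ i j (c : K), i ≠ j → single i j c ∈ R := fun i j c hij => by
    simpa using hmul i j c 1 hij isUnit_one
  have hall : ∀ i j (c : K), single i j c ∈ R := by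
    intro i j c
    by_cases hij : i = j
    · subst hij
      have : Nontrivial (Fin n) := Fin.nontrivial_iff_two_le.mpr hn1
      obtain ⟨k, hk⟩ := exists_ne i
      have h1 := hmul i k c _ hk.symm (htr k i 1 hk)
      rw [transvection, mul_add, mul_one, single_mul_single_same, mul_one] at h1
      exact (R.add_mem_iff_right (hoff i k c hk.symm)).mp h1
    · exact hoff i j c hij
  refine eq_top_iff.mpr fun M _ => ?_
  rw [matrix_eq_sum_single M]
  exact R.sum_mem fun i _ => R.sum_mem fun j _ => hall i j _

/-- All non-singular matrices are values of `u`, so the range of its linear part contains their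
differences and is everything. Hence `u` is injective, and the preimage of the image gives back the
set. -/
theorem isUnit_iff_of_image_eq (hn : 0 < n) (h : 1 < n ∨ 2 < ENat.card K)
    (hu : u '' nonsingularMatrices n K = nonsingularMatrices n K)
    (M : Matrix (Fin n) (Fin n) K) : IsUnit (u M) ↔ IsUnit M := by
  have htop : LinearMap.range u.linear = ⊤ := by
    refine eq_top_of_forall_isUnit_sub_mem hn h fun M N hM hN => ?_
    obtain ⟨A, -, rfl⟩ : M ∈ u '' nonsingularMatrices n K := hu.ge hM
    obtain ⟨B, -, rfl⟩ : N ∈ u '' nonsingularMatrices n K := hu.ge hN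
    exact ⟨A - B, u.linearMap_vsub A B⟩
  have hinj : Function.Injective u := u.linear_injective_iff.mp
    (LinearMap.injective_iff_surjective.mpr (LinearMap.range_eq_top.mp htop))
  have : u ⁻¹' nonsingularMatrices n K = nonsingularMatrices n K := by
    conv_lhs => rw [← hu]
    exact Set.preimage_image_eq _ hinj
  exact Set.ext_iff.mp this M

end Preserver

theorem mainTheorem4 (K : Type*) [Field K] (n : ℕ) (hn : 0 < n)
    (h : n ≠ 2 ∨ 2 < ENat.card K) :
    frobeniusAffineMaps n K =
      {u : Matrix (Fin n) (Fin n) K →ᵃ[K] Matrix (Fin n) (Fin n) K |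
        u ⁻¹' nonsingularMatrices n K = nonsingularMatrices n K} ∧
    ((1 < n ∨ 2 < ENat.card K) →
      frobeniusAffineMaps n K =
        {u : Matrix (Fin n) (Fin n) K →ᵃ[K] Matrix (Fin n) (Fin n) K |
          u '' nonsingularMatrices n K = nonsingularMatrices n K}) := by
  have hpre : ∀ u ∈ frobeniusAffineMaps n K,
      u ⁻¹' nonsingularMatrices n K = nonsingularMatrices n K := by
    rintro u ⟨g, hg, rfl⟩
    ext M
    exact isUnit_frobeniusGroup_apply_iff hg M
  refine ⟨Set.Subset.antisymm hpre fun u hu =>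
    mem_frobeniusAffineMaps_of_isUnit_iff hn h (Set.ext_iff.mp hu), fun h' =>
    Set.Subset.antisymm (fun u hu => ?_) fun u hu =>
      mem_frobeniusAffineMaps_of_isUnit_iff hn h (isUnit_iff_of_image_eq hn h' hu)⟩
  have hu' := hpre u hu
  obtain ⟨g, hg, rfl⟩ := hu
  change _ '' _ = _
  conv_lhs => rw [← hu']
  exact Set.image_preimage_eq _ g.surjective
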